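/- An affine algebraic manifold $X$ is a smooth affine algebraic variety over $\mathbb{C}$, not necessarily connected, with algebra of regular functions $\mathbb{C}[X]$. Algebraic vector fields on $X$ are the $\mathbb{C}$-derivations of $\mathbb{C}[X]$. Such a field $\delta$ is (completely) integrable if through every point of $X$ there passes a holomorphic integral curve of $\delta$ defined for all complex times, and it is locally nilpotent if for every $f\in\mathbb{C}[X]$ there is an $n$ with $\delta^n(f)=0$ (locally nilpotent fields are integrable). $X$ is homogeneous if its group $\operatorname{Aut}X$ of algebraic automorphisms acts transitively on it. A finite subset $M\subset T_{x}X$ is a generating set if the image of $M$ under the action of the isotropy group of $x$ in $\operatorname{Aut}X$ spans $T_{x}X$. $X$ has the algebraic density property if the Lie algebra generated by the integrable algebraic vector fields on $X$ is the Lie algebra of all algebraic vector fields on $X$. **Corollary.** Let $X_1$ and $X_2$ be homogeneous affine algebraic manifolds of positive dimension. Suppose that each $X_i$ admits finitely many integrable algebraic vector fields $\delta_i^1,\dots,\delta_i^{m_i}$ whose values at some point $x_i\in X_i$ form a generating set, and that the fields $\delta_1^1,\dots,\delta_1^{m_1}$ on $X_1$ are locally nilpotent. Then $X_1\times X_2$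 has the algebraic density property. In particular, $\mathbb{C}^k\times(\mathbb{C}^*)^l$ has the algebraic density property for all integers $k\ge 1$, $l\ge 0$ with $k+l\ge 2$. -/

import Mathlib

open scoped TensorProduct

/-!
An affine algebraic manifold `X` over `ℂ` is given by its algebra `A = ℂ[X]` of regular functions,
a smooth `ℂ`-algebra (`Algebra.Smooth ℂ A`: formally smooth and of finite presentation; such an
algebra is automatically reduced).  `X` need not be connected.  Algebraic vector fields on `X` are
the derivations `Derivation ℂ A A`, with the commutator as Lie bracket, and algebraic automorphisms
of `X` are the automorphisms `A ≃ₐ[ℂ] A`.  The regular functions on the product of two such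
manifolds form the tensor product of their algebras of regular functions.
-/

namespace AffineManifold

universe u

variable {A : Type u} [CommRing A] [Algebra ℂ A]

/-- The points of the manifold `X` with algebra of regular functions `A = ℂ[X]`: a point is
identified with the evaluation of regular functions at it. -/
abbrev Point (A : Type u) [CommRing A] [Algebra ℂ A] : Type u := A →ₐ[ℂ] ℂ

/-- The action of an algebraic automorphism on points; `φ` is the pull-back of functions,
so `f (φ · x) = (φ f) (x)`. -/
def movePoint (φ : A ≃ₐ[ℂ] A) (x : Point A) : Point A := x.comp (φ : A →ₐ[ℂ] A)

variable (A) in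
/-- The group of algebraic automorphisms of `X` acts transitively on the points of `X`. -/
def IsHomogeneous : Prop := ∀ x y : Point A, ∃ φ : A ≃ₐ[ℂ] A, movePoint φ x = y

/-- The Zariski tangent space `T_x X`: the `ℂ`-linear functionals on `ℂ[X]` that satisfy
the Leibniz rule at `x`. -/
def tangentSpace (x : Point A) : Submodule ℂ (A →ₗ[ℂ] ℂ) where
  carrier := {v | ∀ f g : A, v (f * g) = x f * v g + x g * v f}
  add_mem' := by
    intro v w hv hw f g
    simp only [LinearMap.add_apply, hv f g, hw f g]
    ring
  zero_mem' := by
    intro f g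
    simp
  smul_mem' := by
    intro c v hv f g
    simp only [LinearMap.smul_apply, hv f g, smul_eq_mul]
    ring

/-- The value at the point `x` of an algebraic vector field, `f ↦ (D f) (x)`. -/
def valueAt (D : Derivation ℂ A A) (x : Point A) : tangentSpace x :=
  ⟨x.toLinearMap ∘ₗ (D : A →ₗ[ℂ] A), by
    intro f g
    simp [Derivation.leibniz]⟩

/-- A finite set `M` of tangent vectors at `x` is a generating set if the image of `M` under the
action of the isotropy group of `x` in `Aut X` spans `T_x X`.  The differential at `x` of the
automorphism given by `φ` maps `v` to `f ↦ v (φ f)`. -/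
def IsGeneratingSet (x : Point A) (M : Set (tangentSpace x)) : Prop :=
  M.Finite ∧
    Submodule.span ℂ {w : tangentSpace x | ∃ φ : A ≃ₐ[ℂ] A, movePoint φ x = x ∧
      ∃ v ∈ M, ∀ f : A, (w : A →ₗ[ℂ] ℂ) f = (v : A →ₗ[ℂ] ℂ) (φ f)} = ⊤

/-- Complete integrability: through every point of `X` passes a holomorphic integral curve of `D`
that is defined for all complex times (the derivative is the complex one). -/
def IsCompletelyIntegrable (D : Derivation ℂ A A) : Prop :=
  ∀ x : Point A, ∃ γ : ℂ → Point A, γ 0 = x ∧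
    ∀ (f : A) (t : ℂ), HasDerivAt (fun s : ℂ => γ s f) (γ t (D f)) t

/-- Local nilpotency: every regular function is killed by a power of the derivation. -/
def IsLocallyNilpotent (D : Derivation ℂ A A) : Prop :=
  ∀ f : A, ∃ n : ℕ, (⇑D)^[n] f = 0

variable (A) in
/-- The algebraic density property of `X`: the Lie algebra generated by the completely integrable
algebraic vector fields is the Lie algebra of all algebraic vector fields. -/
def HasAlgebraicDensityProperty : Prop :=
  LieSubalgebra.lieSpan ℂ (Derivation ℂ A A) {D | IsCompletelyIntegrable D} = ⊤

/-- The algebra of regular functions on `ℂ^k × (ℂ^*)^l`: polynomials in `k` variables tensored with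
Laurent polynomials in `l` variables (the group algebra of `ℤ^l`). -/
abbrev AffineTorusProduct (k l : ℕ) : Type :=
  MvPolynomial (Fin k) ℂ ⊗[ℂ] AddMonoidAlgebra ℂ (Fin l → ℤ)

end AffineManifold

/-! Call a field absorbed if all its multiples by regular functions lie in the Lie algebra generated
by the integrable fields. The absorbed fields form a module over the regular functions, stable under
automorphisms and under brackets with elements of that Lie algebra. By Nakayama this module is
everything as soon as its values fill each tangent space (`hasAlgebraicDensityProperty_of_fiber`).

On a product, take a locally nilpotent `D` on the first factor, a function `a` with `D a ≠ 0` and `D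
(D a) = 0`, and an integrable `E` on the second. For `f`, `g` from the first and second factor, `[g
D, a f E] - [a g D, f E] = f g D(a) E`. All four fields are integrable: each coefficient is killed
by its field, except `a g`, which is affine along the flow of `D`. Hence `D(a) E` is absorbed
(`smul_extendRight_mem_absorbedFields`). Brackets with multiples of an integrable field `δ` of the
first factor then show that `D(a) E(g) δ` is absorbed (`smul_extendLeft_mem_absorbedFields`).

At a point where `D a` and some `E g` do not vanish, the values of all given fields on both factors
are thus values of absorbed fields. The isotropy groups of the factors enlarge them to the whole
tangent space, and homogeneity carries this to every point. Smoothness in positive dimension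
guarantees nonzero tangent vectors, so the generating sets are not zero. -/

namespace AffineManifold

variable {A B : Type*} [CommRing A] [Algebra ℂ A] [CommRing B] [Algebra ℂ B]

/-! ### Integral curves: time changes and flows of locally nilpotent fields. -/

section Flows

/-- Reparametrizing integral curves: `h • D` is completely integrable as soon as `h` is affine
along the integral curves of `D`. -/
theorem IsCompletelyIntegrable.smul {D : Derivation ℂ A A} (hD : IsCompletelyIntegrable D)
    {h : A} (hh : D (D h) = 0) : IsCompletelyIntegrable (h • D) := by
  intro x
  obtain ⟨γ, h0, hγ⟩ := hD x
  have hconst : ∀ t, γ t (D h) = x (D h) := by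
    intro t
    have := is_const_of_deriv_eq_zero (f := fun s => γ s (D h))
      (fun t => (hγ (D h) t).differentiableAt) (fun t => by rw [(hγ (D h) t).deriv, hh, map_zero])
      t 0
    simpa [h0] using this
  have haff : ∀ t, γ t h = x h + x (D h) * t := by
    intro t
    have hd : ∀ t, HasDerivAt (fun s => γ s h - x (D h) * s) 0 t := by
      intro t
      have h1 := (hγ h t).sub ((hasDerivAt_id t).const_mul (x (D h)))
      rw [hconst t, mul_one, sub_self] at h1
      exact h1
    have := is_const_of_deriv_eq_zero (f := fun s => γ s h - x (D h) * s)
      (fun t => (hd t).differentiableAt) (fun t => (hd t).deriv) t 0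
    simp only [h0, mul_zero, sub_zero] at this
    rw [← this]; ring
  -- Since `h` is affine along `γ`, the time change that turns `γ` into an integral curve of `h • D`
  -- solves a linear equation, whose solution is entire.
  obtain ⟨s, hs0, hs⟩ : ∃ s : ℂ → ℂ, s 0 = 0 ∧
      ∀ t, HasDerivAt s (x h + x (D h) * s t) t := by
    by_cases hb : x (D h) = 0
    · refine ⟨fun t => x h * t, by simp, fun t => ?_⟩
      simpa [hb] using (hasDerivAt_id t).const_mul (x h)
    · refine ⟨fun t => x h / x (D h) * (Complex.exp (x (D h) * t) - 1), by simp, fun t => ?_⟩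
      have h1 := ((((hasDerivAt_id t).const_mul (x (D h))).cexp).sub_const 1).const_mul
        (x h / x (D h))
      refine HasDerivAt.congr_deriv h1 ?_
      simp only [id, mul_one]
      field_simp
      ring
  refine ⟨fun t => γ (s t), by simp [hs0, h0], fun f t => ?_⟩
  have := (hγ f (s t)).comp t (hs t)
  simpa [haff (s t), mul_comm, Function.comp_def] using this

theorem IsCompletelyIntegrable.smul_of_ker {D : Derivation ℂ A A}
    (hD : IsCompletelyIntegrable D) {h : A} (hh : D h = 0) : IsCompletelyIntegrable (h • D) :=
  hD.smul (by rw [hh, map_zero])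

open Polynomial in
/-- The Taylor polynomial `∑ tⁿ/n! (Dⁿ f)(x)` of a function along a locally nilpotent field. -/
noncomputable def taylor (D : Derivation ℂ A A) (x : Point A) (n : ℕ) (f : A) : ℂ[X] :=
  ∑ i ∈ Finset.range n, C (x ((⇑D)^[i] f) / (i.factorial : ℂ)) * X ^ i

theorem iterate_eq_zero_of_le {D : Derivation ℂ A A} {f : A} {n m : ℕ} (h : n ≤ m)
    (hn : (⇑D)^[n] f = 0) : (⇑D)^[m] f = 0 := by
  obtain ⟨k, rfl⟩ := Nat.exists_eq_add_of_le' h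
  rw [Function.iterate_add_apply, hn]
  exact Function.iterate_fixed (map_zero D) k

theorem taylor_eq_of_le {D : Derivation ℂ A A} (x : Point A) {f : A} {n m : ℕ} (h : n ≤ m)
    (hn : (⇑D)^[n] f = 0) : taylor D x m f = taylor D x n f := by
  symm
  refine Finset.sum_subset (Finset.range_mono h) fun i _ hi => ?_
  rw [iterate_eq_zero_of_le (by simpa using hi) hn]
  simp

theorem taylor_derivative (D : Derivation ℂ A A) (x : Point A) (n : ℕ) (f : A) :
    (taylor D x (n + 1) f).derivative = taylor D x n (D f) := by
  rw [taylor, Finset.sum_range_succ']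
  simp only [map_add, map_sum, taylor]
  simp only [pow_zero, mul_one, Polynomial.derivative_C, add_zero]
  refine Finset.sum_congr rfl fun i _ => ?_
  rw [Polynomial.derivative_C_mul_X_pow, Function.iterate_succ_apply]
  congr 2
  rw [Nat.factorial_succ]
  have := Nat.cast_add_one_ne_zero (R := ℂ) i
  have := Nat.cast_ne_zero (R := ℂ).2 i.factorial_ne_zero
  push_cast
  field_simp

theorem taylor_coeff_zero (D : Derivation ℂ A A) (x : Point A) (n : ℕ) (f : A) :
    (taylor D x (n + 1) f).coeff 0 = x f := by
  simp [taylor, Finset.sum_range_succ', Polynomial.coeff_X_pow]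

theorem taylor_add (D : Derivation ℂ A A) (x : Point A) (n : ℕ) (f g : A) :
    taylor D x n (f + g) = taylor D x n f + taylor D x n g := by
  simp only [taylor, iterate_map_add, map_add, add_div, add_mul, Finset.sum_add_distrib]

theorem polynomial_ext_of_derivative {p q : Polynomial ℂ} (h : p.derivative = q.derivative)
    (h0 : p.coeff 0 = q.coeff 0) : p = q := by
  ext n
  cases n with
  | zero => exact h0
  | succ n =>
    have := congrArg (fun r => Polynomial.coeff r n) h
    simp only [Polynomial.coeff_derivative] at this
    exact mul_right_cancel₀ (Nat.cast_add_one_ne_zero n) this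

/-- The Leibniz rule gives both sides the same derivative, by induction, and they have the same
constant term; no binomial sums are needed. This is what makes the flow multiplicative. -/
theorem taylor_mul_aux (D : Derivation ℂ A A) (x : Point A) (k : ℕ) :
    ∀ (n m : ℕ) (f g : A), n + m ≤ k → (⇑D)^[n] f = 0 → (⇑D)^[m] g = 0 →
      (⇑D)^[k] (f * g) = 0 ∧ taylor D x k (f * g) = taylor D x k f * taylor D x k g := by
  induction k with
  | zero =>
    intro n m f g h hf hg
    obtain rfl : n = 0 := by omega
    obtain rfl : f = 0 := hf
    simp [taylor]
  | succ k ih =>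
    intro n m f g h hf hg
    have hz : ∀ l, (⇑D)^[l] (0 : A) = 0 := fun l => Function.iterate_fixed (map_zero D) l
    have h1 : (⇑D)^[k] (D f * g) = 0 ∧
        taylor D x k (D f * g) = taylor D x k (D f) * taylor D x k g := by
      cases n with
      | zero =>
        obtain rfl : f = 0 := hf
        simp [taylor, hz]
      | succ n => exact ih n m (D f) g (by omega) hf hg
    have h2 : (⇑D)^[k] (f * D g) = 0 ∧
        taylor D x k (f * D g) = taylor D x k f * taylor D x k (D g) := by
      cases m with
      | zero =>
        obtain rfl : g = 0 := hg
        simp [taylor, hz]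
      | succ m => exact ih n m f (D g) (by omega) hf hg
    have hl : D (f * g) = D f * g + f * D g := by
      rw [Derivation.leibniz, smul_eq_mul, smul_eq_mul]; ring
    refine ⟨by rw [Function.iterate_succ_apply, hl, iterate_map_add, h1.1, h2.1, add_zero], ?_⟩
    apply polynomial_ext_of_derivative
    · rw [Polynomial.derivative_mul, taylor_derivative, taylor_derivative, taylor_derivative, hl,
        taylor_add, h1.2, h2.2]
      congr 1
      · cases n with
        | zero =>
          obtain rfl : f = 0 := hf
          simp [taylor, hz]
        -- Here the exponent for `f` is positive, so `m ≤ k` and truncating at `k` or `k + 1` makes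
        -- no difference for `g`.
        | succ n => rw [taylor_eq_of_le x (k.le_succ) (iterate_eq_zero_of_le (by omega) hg)]
      · cases m with
        | zero =>
          obtain rfl : g = 0 := hg
          simp [taylor, hz]
        | succ m => rw [taylor_eq_of_le x (k.le_succ) (iterate_eq_zero_of_le (by omega) hf)]
    · rw [Polynomial.mul_coeff_zero, taylor_coeff_zero, taylor_coeff_zero, taylor_coeff_zero,
        map_mul]

/-- Locally nilpotent fields are completely integrable: their flow is `∑ tⁿ/n! Dⁿ`. -/
theorem IsLocallyNilpotent.isCompletelyIntegrable {D : Derivation ℂ A A}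
    (hD : IsLocallyNilpotent D) : IsCompletelyIntegrable D := by
  intro x
  choose N hN using hD
  -- The chosen truncation `N f` depends on `f` in no coherent way; any order that kills `f` may
  -- replace it.
  have key : ∀ (f : A) (n : ℕ), (⇑D)^[n] f = 0 → taylor D x (N f) f = taylor D x n f := by
    intro f n hn
    rcases le_total (N f) n with h | h
    · exact (taylor_eq_of_le x h (hN f)).symm
    · exact taylor_eq_of_le x h hn
  refine ⟨fun t => AlgHom.ofLinearMap
    { toFun := fun f => (taylor D x (N f) f).eval t
      map_add' := ?_
      map_smul' := ?_ } ?_ ?_, ?_, ?_⟩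
  · intro f g
    have hf := iterate_eq_zero_of_le (le_max_left (N f) (N g)) (hN f)
    have hg := iterate_eq_zero_of_le (le_max_right (N f) (N g)) (hN g)
    rw [key f _ hf, key g _ hg, key (f + g) _ (by rw [iterate_map_add, hf, hg, add_zero]),
      taylor_add, Polynomial.eval_add]
  · intro c f
    have hi : ∀ i, (⇑D)^[i] (c • f) = c • (⇑D)^[i] f := fun i => by
      induction i with
      | zero => rfl
      | succ i ih => rw [Function.iterate_succ_apply', ih, Derivation.map_smul, Function.iterate_succ_apply']
    rw [key (c • f) (N f) (by rw [hi, hN, smul_zero])]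
    simp [taylor, Polynomial.eval_finsetSum, hi, Finset.mul_sum, mul_assoc, mul_div_assoc]
  · change (taylor D x (N 1) 1).eval t = 1
    rw [key 1 1 (by simp)]
    simp [taylor]
  · intro f g
    change (taylor D x (N (f * g)) (f * g)).eval t =
      (taylor D x (N f) f).eval t * (taylor D x (N g) g).eval t
    have := taylor_mul_aux D x (N f + N g) (N f) (N g) f g le_rfl (hN f) (hN g)
    rw [key _ _ this.1, this.2, Polynomial.eval_mul,
      key f _ (iterate_eq_zero_of_le (Nat.le_add_right _ _) (hN f)),
      key g _ (iterate_eq_zero_of_le (Nat.le_add_left _ _) (hN g))]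
  · ext f
    change (taylor D x (N f) f).eval 0 = x f
    rw [key f (N f + 1) (iterate_eq_zero_of_le (Nat.le_succ _) (hN f)),
      ← Polynomial.coeff_zero_eq_eval_zero, taylor_coeff_zero]
  · intro f t
    change HasDerivAt (fun s => (taylor D x (N f) f).eval s) ((taylor D x (N (D f)) (D f)).eval t) t
    have hf := iterate_eq_zero_of_le (Nat.le_succ (N f)) (hN f)
    rw [key f _ hf, key (D f) (N f) hf, ← taylor_derivative]
    exact Polynomial.hasDerivAt _ t

end Flows

/-! ### Transport along isomorphisms and the module of absorbed fields. -/

section Conj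

/-- Transport of an algebraic vector field along an isomorphism. -/
def conj (φ : A ≃ₐ[ℂ] B) (D : Derivation ℂ A A) : Derivation ℂ B B :=
  Derivation.mk' (φ.toLinearMap ∘ₗ (D : A →ₗ[ℂ] A) ∘ₗ φ.symm.toLinearMap) fun f g => by
    simp [Derivation.leibniz]

@[simp] theorem conj_apply (φ : A ≃ₐ[ℂ] B) (D : Derivation ℂ A A) (f : B) :
    conj φ D f = φ (D (φ.symm f)) := rfl

theorem conj_smul (φ : A ≃ₐ[ℂ] B) (D : Derivation ℂ A A) (a : A) :
    conj φ (a • D) = φ a • conj φ D := by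
  ext f; simp

theorem IsCompletelyIntegrable.conj {D : Derivation ℂ A A} (hD : IsCompletelyIntegrable D)
    (φ : A ≃ₐ[ℂ] B) : IsCompletelyIntegrable (conj φ D) := by
  intro y
  obtain ⟨γ, h0, hγ⟩ := hD (y.comp (φ : A →ₐ[ℂ] B))
  refine ⟨fun t => (γ t).comp (φ.symm : B →ₐ[ℂ] A), ?_, fun f t => ?_⟩
  · ext f; simp [h0]
  · simpa using hγ (φ.symm f) t

theorem IsLocallyNilpotent.conj {D : Derivation ℂ A A} (hD : IsLocallyNilpotent D)
    (φ : A ≃ₐ[ℂ] B) : IsLocallyNilpotent (conj φ D) := by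
  intro f
  obtain ⟨n, hn⟩ := hD (φ.symm f)
  have : ∀ k, (⇑(AffineManifold.conj φ D))^[k] f = φ ((⇑D)^[k] (φ.symm f)) := fun k => by
    induction k with
    | zero => simp
    | succ k ih => simp [Function.iterate_succ_apply', ih]
  exact ⟨n, by rw [this, hn, map_zero]⟩

variable (A) in
/-- The Lie algebra generated by the completely integrable algebraic vector fields. -/
abbrev integrableLie : LieSubalgebra ℂ (Derivation ℂ A A) :=
  LieSubalgebra.lieSpan ℂ (Derivation ℂ A A) {D | IsCompletelyIntegrable D}

theorem IsCompletelyIntegrable.mem {D : Derivation ℂ A A} (hD : IsCompletelyIntegrable D) :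
    D ∈ integrableLie A := LieSubalgebra.subset_lieSpan hD

theorem conj_mem_integrableLie (φ : A ≃ₐ[ℂ] B) {D : Derivation ℂ A A}
    (hD : D ∈ integrableLie A) : conj φ D ∈ integrableLie B := by
  induction hD using LieSubalgebra.lieSpan_induction with
  | mem D hD => exact (IsCompletelyIntegrable.conj hD φ).mem
  | zero => convert (integrableLie B).zero_mem; ext; simp
  | add D E _ _ hD hE => convert (integrableLie B).add_mem hD hE; ext; simp
  | smul c D _ hD => convert (integrableLie B).smul_mem c hD; ext; simp
  | lie D E _ _ hD hE =>
    convert (integrableLie B).lie_mem hD hE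
    ext; simp [Derivation.commutator_apply]

theorem HasAlgebraicDensityProperty.of_algEquiv (h : HasAlgebraicDensityProperty A)
    (φ : A ≃ₐ[ℂ] B) : HasAlgebraicDensityProperty B := by
  refine eq_top_iff.2 fun D _ => ?_
  have h1 : conj φ.symm D ∈ integrableLie A := by rw [integrableLie, h]; trivial
  convert conj_mem_integrableLie φ h1
  ext f; simp

variable (A) in
/-- The fields all of whose multiples by regular functions lie in the Lie algebra generated by
the completely integrable fields. -/
def absorbedFields : Submodule A (Derivation ℂ A A) where
  carrier := {D | ∀ f : A, f • D ∈ integrableLie A}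
  add_mem' hD hE f := by rw [smul_add]; exact add_mem (hD f) (hE f)
  zero_mem' f := by rw [smul_zero]; exact zero_mem _
  smul_mem' a D hD f := by rw [smul_smul]; exact hD _

theorem conj_mem_absorbedFields (φ : A ≃ₐ[ℂ] B) {D : Derivation ℂ A A}
    (hD : D ∈ absorbedFields A) : conj φ D ∈ absorbedFields B := by
  intro f
  convert conj_mem_integrableLie φ (hD (φ.symm f))
  rw [conj_smul, AlgEquiv.apply_symm_apply]

theorem lie_smul_field (D E : Derivation ℂ A A) (f : A) : ⁅D, f • E⁆ = f • ⁅D, E⁆ + D f • E := by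
  ext g
  simp [Derivation.commutator_apply]

/-- In `[D, f E] = f [D, E] + D(f) E`, the left side and the last term already lie in the Lie
algebra. -/
theorem lie_mem_absorbedFields {D E : Derivation ℂ A A} (hD : D ∈ integrableLie A)
    (hE : E ∈ absorbedFields A) : ⁅D, E⁆ ∈ absorbedFields A := by
  intro f
  have := (integrableLie A).sub_mem ((integrableLie A).lie_mem hD (hE f)) (hE (D f))
  rwa [lie_smul_field, add_sub_cancel_right] at this

/-- The values at `x` of the absorbed fields. -/
def absorbedFiber (x : Point A) : Submodule ℂ (A →ₗ[ℂ] ℂ) where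
  carrier := {v | ∃ D ∈ absorbedFields A, ∀ f, v f = x (D f)}
  add_mem' := by
    rintro v w ⟨D, hD, h⟩ ⟨E, hE, h'⟩
    exact ⟨D + E, add_mem hD hE, fun f => by simp [h, h']⟩
  zero_mem' := ⟨0, zero_mem _, by simp⟩
  smul_mem' := by
    rintro c v ⟨D, hD, h⟩
    refine ⟨algebraMap ℂ A c • D, (absorbedFields A).smul_mem _ hD, fun f => by simp [h]⟩

theorem comp_mem_absorbedFiber {x : Point A} {v : A →ₗ[ℂ] ℂ} (hv : v ∈ absorbedFiber x)
    (φ : A ≃ₐ[ℂ] A) : v ∘ₗ φ.toLinearMap ∈ absorbedFiber (movePoint φ x) := by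
  obtain ⟨D, hD, h⟩ := hv
  exact ⟨conj φ.symm D, conj_mem_absorbedFields _ hD, fun f => by simp [h, movePoint]⟩

end Conj

/-! ### Smooth algebras: Euler fields, reducedness, tangent vectors, Nakayama. -/

section SmoothAlgebra

open KaehlerDifferential

variable {A : Type*} [CommRing A] [Algebra ℂ A]

/-- The maximal ideal of functions vanishing at a point. -/
abbrev vanishing (x : Point A) : Ideal A := RingHom.ker x

theorem sub_mem_vanishing (x : Point A) (f : A) : f - algebraMap ℂ A (x f) ∈ vanishing x := by
  simp [RingHom.mem_ker]

theorem exists_point_of_isMaximal [Algebra.FiniteType ℂ A] (m : Ideal A) [hm : m.IsMaximal] :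
    ∃ x : Point A, vanishing x = m := by
  let := Ideal.Quotient.field m
  have : Module.Finite ℂ (A ⧸ m) := finite_of_finite_type_of_isJacobsonRing ℂ (A ⧸ m)
  have hb : Function.Bijective (algebraMap ℂ (A ⧸ m)) :=
    IsAlgClosed.algebraMap_bijective_of_isIntegral
  let e : ℂ ≃ₐ[ℂ] (A ⧸ m) := AlgEquiv.ofBijective (Algebra.ofId ℂ (A ⧸ m)) hb
  refine ⟨(e.symm : (A ⧸ m) →ₐ[ℂ] ℂ).comp (Ideal.Quotient.mkₐ ℂ m), ?_⟩
  ext f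
  simp [RingHom.mem_ker, Ideal.Quotient.eq_zero_iff_mem]

/-- A field on a smooth variety whose coefficients lie in a finitely generated ideal is a
combination of fields with coefficients in the ideal. -/
theorem mem_smul_top_of_forall_mem [Algebra.FormallySmooth ℂ A] {I : Ideal A} (hI : I.FG)
    {D : Derivation ℂ A A} (hD : ∀ f, D f ∈ I) :
    D ∈ I • (⊤ : Submodule A (Derivation ℂ A A)) := by
  have : Module.Finite A I := Module.Finite.iff_fg.2 hI
  obtain ⟨n, p, hp⟩ := Module.Finite.exists_fin' A I
  let D' : Derivation ℂ A I := Derivation.mk'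
    { toFun := fun f => ⟨D f, hD f⟩
      map_add' := fun f g => Subtype.ext (by simp)
      map_smul' := fun c f => Subtype.ext (by simp) } fun f g => Subtype.ext (by simp)
  -- Formal smoothness makes the Kähler differentials projective, so `D`, seen as a map into `I`,
  -- lifts to the free module over `I`.
  obtain ⟨h, hh⟩ := Module.projective_lifting_property p D'.liftKaehlerDifferential hp
  have : D = ∑ i, (p (Pi.single i 1) : A) •
      ((LinearMap.proj i ∘ₗ h).compDer (KaehlerDifferential.D ℂ A)) := by
    ext f
    have h1 : (D' f : A) = D f := rfl
    have h2 : p (h (KaehlerDifferential.D ℂ A f)) = D' f := by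
      rw [← LinearMap.comp_apply, hh, Derivation.liftKaehlerDifferential_comp_D]
    rw [← h1, ← h2]
    conv_lhs => rw [pi_eq_sum_univ' (h (KaehlerDifferential.D ℂ A f)), map_sum]
    rw [← Derivation.coeFnAddMonoidHom_apply (∑ i, _), map_sum]
    simp [mul_comm]
  rw [this]
  exact Submodule.sum_mem _ fun i _ => Submodule.smul_mem_smul (p _).2 trivial

/-- At every point of a smooth variety there is a field that looks like the Euler field. -/
theorem exists_euler_field [Algebra.FormallySmooth ℂ A] (x : Point A) :
    ∃ E : Derivation ℂ A A, (∀ f, E f ∈ vanishing x) ∧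
      ∀ f ∈ vanishing x, E f - f ∈ vanishing x ^ 2 := by
  let I := vanishing x
  let e : A →ₗ[ℂ] I :=
    { toFun := fun f => ⟨f - algebraMap ℂ A (x f), sub_mem_vanishing x f⟩
      map_add' := fun f g => Subtype.ext (by simp; ring)
      map_smul' := fun c f => Subtype.ext (by simp [mul_sub, Algebra.smul_def]) }
  let d : Derivation ℂ A I.Cotangent :=
    Derivation.mk' ((I.toCotangent.restrictScalars ℂ) ∘ₗ e) fun f g => by
      change I.toCotangent (e (f * g)) = f • I.toCotangent (e g) + g • I.toCotangent (e f)
      rw [← map_smul I.toCotangent f, ← map_smul I.toCotangent g, ← map_add, Ideal.toCotangent_eq]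
      have := neg_mem (Ideal.mul_mem_mul (sub_mem_vanishing x f) (sub_mem_vanishing x g))
      rw [← pow_two] at this
      convert this using 1
      simp [e]
      ring
  obtain ⟨h, hh⟩ := Module.projective_lifting_property I.toCotangent d.liftKaehlerDifferential
    I.toCotangent_surjective
  refine ⟨(I.subtype ∘ₗ h).compDer (KaehlerDifferential.D ℂ A), fun f => (h _).2, fun f hf => ?_⟩
  have h2 : I.toCotangent (h (KaehlerDifferential.D ℂ A f)) = d f := by
    rw [← LinearMap.comp_apply, hh, Derivation.liftKaehlerDifferential_comp_D]
  have h3 : d f = I.toCotangent ⟨f, hf⟩ := by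
    refine (Ideal.toCotangent_eq _).2 ?_
    have : x f = 0 := hf
    simp [e, this]
  rw [h3, Ideal.toCotangent_eq] at h2
  exact h2

theorem apply_mem_mul_of_mem_smul_top {I J : Ideal A} {D : Derivation ℂ A A}
    (hD : D ∈ I • (⊤ : Submodule A (Derivation ℂ A A))) {f : A}
    (hf : ∀ D' : Derivation ℂ A A, D' f ∈ J) : D f ∈ I * J := by
  refine Submodule.smul_induction_on (p := fun D : Derivation ℂ A A => D f ∈ I * J) hD
    (fun r hr D' _ => Ideal.mul_mem_mul hr (hf D')) fun D₁ D₂ h₁ h₂ => add_mem h₁ h₂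

/-- Differentiating a relation `f ^ (l + 1) * D f ^ j = 0` and multiplying by `D f` trades one
factor `f` for two factors `D f`, up to the scalar `l + 1`, a unit in characteristic zero. -/
theorem isNilpotent_derivation_apply (D : Derivation ℂ A A) {f : A} (hf : IsNilpotent f) :
    IsNilpotent (D f) := by
  obtain ⟨n, hn⟩ := hf
  have key : ∀ k ≤ n, ∃ j, f ^ (n - k) * D f ^ j = 0 := by
    intro k
    induction k with
    | zero => exact fun _ => ⟨0, by simp [hn]⟩
    | succ k ih =>
      intro hk
      obtain ⟨j, hj⟩ := ih (by omega)
      obtain ⟨l, hl⟩ : ∃ l, n - k = l + 1 := ⟨n - k - 1, by omega⟩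
      have hl' : n - (k + 1) = l := by omega
      rw [hl']
      rw [hl] at hj
      refine ⟨j + 2, ?_⟩
      have h1 := congrArg (fun g => D f * D g) hj
      have h2 : D f * (D f ^ (j - 1) * f ^ (l + 1) * j) = j * (f ^ (l + 1) * D f ^ j) := by
        cases j with
        | zero => simp
        | succ j => simp only [Nat.add_sub_cancel, pow_succ]; ring
      simp only [Derivation.leibniz, Derivation.leibniz_pow, smul_eq_mul, nsmul_eq_mul, map_zero,
        mul_zero, Nat.add_sub_cancel] at h1
      have h3 : ((l + 1 : ℕ) : A) * (f ^ l * D f ^ (j + 2)) = 0 := by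
        linear_combination h1 - D (D f) * h2 - j * D (D f) * hj
      have h4 : IsUnit ((l + 1 : ℕ) : A) := by
        have := (IsUnit.mk0 ((l + 1 : ℕ) : ℂ) (Nat.cast_ne_zero.2 l.succ_ne_zero)).map
          (algebraMap ℂ A)
        rwa [map_natCast] at this
      exact h4.mul_right_eq_zero.1 h3
  obtain ⟨j, hj⟩ := key n le_rfl
  exact ⟨j, by simpa using hj⟩

/-- An Euler field acts on the `k`-th graded piece of the maximal-adic filtration as multiplication
by `k`. -/
theorem euler_field_sub_mem {x : Point A} {E : Derivation ℂ A A}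
    (h1 : ∀ f, E f ∈ vanishing x) (h2 : ∀ f ∈ vanishing x, E f - f ∈ vanishing x ^ 2)
    (k : ℕ) : ∀ f ∈ vanishing x ^ k, E f - k * f ∈ vanishing x ^ (k + 1) := by
  induction k with
  | zero => intro f _; simpa using h1 f
  | succ k ih =>
    intro f hf
    rw [pow_succ] at hf
    refine Submodule.mul_induction_on hf (fun a ha b hb => ?_) fun a b ha hb => ?_
    · have e1 := Ideal.mul_mem_mul (ih a ha) hb
      have e2 := Ideal.mul_mem_mul ha (h2 b hb)
      rw [← pow_succ] at e1
      rw [← pow_add] at e2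
      convert add_mem e1 e2 using 1
      simp only [Derivation.leibniz, smul_eq_mul]
      push_cast
      ring
    · convert add_mem ha hb using 1
      rw [map_add]
      ring

/-- Smooth complex algebras are reduced: a regular function vanishing at all points is zero. -/
theorem eq_zero_of_forall_point [Algebra.Smooth ℂ A] {f : A} (hf : ∀ x : Point A, x f = 0) :
    f = 0 := by
  have : IsNoetherianRing A := Algebra.FiniteType.isNoetherianRing ℂ A
  have : IsJacobsonRing A := isJacobsonRing_of_finiteType (A := ℂ)
  have hnil : IsNilpotent f := by
    rw [← mem_nilradical, nilradical, Ideal.radical_eq_jacobson, Ideal.jacobson, Submodule.mem_sInf]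
    rintro m ⟨-, hm⟩
    obtain ⟨x, rfl⟩ := exists_point_of_isMaximal m
    exact hf x
  have hpow : ∀ (x : Point A) (k : ℕ) (f : A), IsNilpotent f → f ∈ vanishing x ^ k := by
    intro x k
    obtain ⟨E, h1, h2⟩ := exists_euler_field x
    have hE := mem_smul_top_of_forall_mem (IsNoetherian.noetherian (vanishing x)) h1
    have h0 : ∀ f : A, IsNilpotent f → f ∈ vanishing x := fun f hf =>
      (hf.map x).eq_zero
    induction k with
    | zero => simp
    | succ k ih =>
      intro f hf
      cases k with
      | zero => simpa using h0 f hf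
      | succ k =>
        -- Derivatives of `f` are nilpotent, hence of order `k + 1` by induction; as `E` has
        -- coefficients in the ideal, `E f` has order `k + 2`. Comparison with `(k + 1) f` raises
        -- the order of `f`.
        have e1 := apply_mem_mul_of_mem_smul_top hE
          fun D => ih (D f) (isNilpotent_derivation_apply D hf)
        rw [← pow_succ'] at e1
        have e2 := sub_mem e1 (euler_field_sub_mem h1 h2 (k + 1) f (ih f hf))
        rw [sub_sub_cancel] at e2
        have h4 : IsUnit ((k + 1 : ℕ) : A) := by
          have := (IsUnit.mk0 ((k + 1 : ℕ) : ℂ) (Nat.cast_ne_zero.2 k.succ_ne_zero)).map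
            (algebraMap ℂ A)
          rwa [map_natCast] at this
        exact (Ideal.unit_mul_mem_iff_mem _ h4).1 e2
  have htop : (Ideal.span {f}).annihilator = ⊤ := by
    by_contra hne
    obtain ⟨m, hm, hle⟩ := Ideal.exists_le_maximal _ hne
    obtain ⟨x, rfl⟩ := exists_point_of_isMaximal m
    -- Krull's intersection theorem: `r f = f` with `r` in the maximal ideal, so `1 - r` annihilates
    -- `f`.
    obtain ⟨r, hr⟩ := (Ideal.mem_iInf_smul_pow_eq_bot_iff (vanishing x) f).1
      (by simpa [Submodule.mem_iInf] using fun i => hpow x i f hnil)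
    have : 1 - (r : A) ∈ (Ideal.span {f}).annihilator := by
      rw [← Ideal.submodule_span_eq, Submodule.mem_annihilator_span_singleton]
      rw [sub_smul, one_smul, hr, sub_self]
    refine (Ideal.ne_top_iff_one _).1 hm.ne_top ?_
    simpa using add_mem (hle this) r.2
  have := (Ideal.eq_top_iff_one _).1 htop
  rwa [← Ideal.submodule_span_eq, Submodule.mem_annihilator_span_singleton, one_smul] at this

/-- A smooth variety of positive dimension has a point with a non-zero tangent vector. -/
theorem exists_apply_ne_zero_of_ringKrullDim_pos [Algebra.Smooth ℂ A]
    (hdim : 0 < ringKrullDim A) : ∃ (x : Point A) (D : Derivation ℂ A A) (f : A), x (D f) ≠ 0 := by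
  by_contra! hz
  have : IsNoetherianRing A := Algebra.FiniteType.isNoetherianRing ℂ A
  refine hdim.not_ge (Ring.krullDimLE_iff.1 (Ring.krullDimLE_zero_iff.2 fun p hp => ?_))
  obtain ⟨m, hm, hpm⟩ := Ideal.exists_le_maximal p hp.ne_top
  obtain ⟨x, rfl⟩ := exists_point_of_isMaximal m
  obtain ⟨E, h1, h2⟩ := exists_euler_field x
  have hE := mem_smul_top_of_forall_mem (IsNoetherian.noetherian (vanishing x)) h1
  -- If all fields vanish everywhere, `E f` lies in the square of the ideal, and so does `f`. The
  -- ideal is then generated by an idempotent, which forces every prime below it to equal it.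
  have hid : IsIdempotentElem (vanishing x) := by
    refine le_antisymm Ideal.mul_le_right fun f hf => ?_
    have e1 : E f ∈ vanishing x * vanishing x :=
      apply_mem_mul_of_mem_smul_top hE fun D => hz x D f
    have e2 := h2 f hf
    rw [pow_two] at e2
    simpa using sub_mem e1 e2
  obtain ⟨e, he, hspan⟩ :=
    (Ideal.isIdempotentElem_iff_of_fg _ (IsNoetherian.noetherian (vanishing x))).1 hid
  suffices h : vanishing x ≤ p by rwa [le_antisymm hpm h]
  have hex : e ∈ vanishing x := by rw [hspan]; exact Submodule.mem_span_singleton_self e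
  have h0 : e * (1 - e) ∈ p := by rw [mul_sub, mul_one, he.eq, sub_self]; exact p.zero_mem
  rcases hp.mem_or_mem h0 with h | h
  · rw [hspan]; exact (Submodule.span_singleton_le_iff_mem _ _).2 h
  · exact absurd (by simpa using add_mem (hpm h) hex) ((Ideal.ne_top_iff_one _).1 hm.ne_top)

/-- If the absorbed fields span all tangent spaces, the density property holds. -/
theorem hasAlgebraicDensityProperty_of_fiber [Algebra.Smooth ℂ A]
    (h : ∀ (x : Point A), ∀ v ∈ tangentSpace x, v ∈ absorbedFiber x) :
    HasAlgebraicDensityProperty A := by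
  have : IsNoetherianRing A := Algebra.FiniteType.isNoetherianRing ℂ A
  have : Module.Finite A (Derivation ℂ A A) :=
    Module.Finite.equiv (KaehlerDifferential.linearMapEquivDerivation ℂ A)
  suffices htop : absorbedFields A = ⊤ by
    refine eq_top_iff.2 fun D _ => ?_
    have : D ∈ absorbedFields A := htop ▸ trivial
    simpa using this 1
  by_contra hne
  let Q := Derivation ℂ A A ⧸ absorbedFields A
  have hann : Module.annihilator A Q ≠ ⊤ := by
    intro htop
    refine hne (eq_top_iff.2 fun D _ => ?_)
    have h1 : (1 : A) ∈ Module.annihilator A Q := htop ▸ trivial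
    have := Module.mem_annihilator.1 h1 (Submodule.Quotient.mk D)
    rwa [one_smul, Submodule.Quotient.mk_eq_zero] at this
  obtain ⟨m, hm, hle⟩ := Ideal.exists_le_maximal _ hann
  obtain ⟨x, rfl⟩ := exists_point_of_isMaximal m
  -- Nakayama for the quotient: a field that agrees at `x` with an absorbed one differs from it by a
  -- field with coefficients in the ideal, hence by an element of the ideal times all fields.
  obtain ⟨r, hr, hr'⟩ := Submodule.exists_sub_one_mem_and_smul_eq_zero_of_fg_of_le_smul
    (vanishing x) (⊤ : Submodule A Q) Module.Finite.fg_top (by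
      rintro q -
      obtain ⟨D, rfl⟩ := Submodule.Quotient.mk_surjective _ q
      obtain ⟨E, hE, hDE⟩ := h x _ (valueAt D x).2
      have : D - E ∈ vanishing x • (⊤ : Submodule A (Derivation ℂ A A)) :=
        mem_smul_top_of_forall_mem (IsNoetherian.noetherian _) fun f => by
          have := hDE f
          simp only [valueAt, LinearMap.comp_apply] at this
          rw [RingHom.mem_ker, Derivation.sub_apply, map_sub, ← this]
          exact sub_self _
      have h1 := Submodule.mem_map_of_mem (f := (absorbedFields A).mkQ) this
      rw [Submodule.map_smul'', Submodule.map_top, Submodule.range_mkQ, map_sub] at h1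
      have h2 : (absorbedFields A).mkQ E = 0 := (Submodule.Quotient.mk_eq_zero _).2 hE
      rwa [h2, sub_zero] at h1)
  have hrm : r ∈ vanishing x := hle (Module.mem_annihilator.2 fun q => hr' q trivial)
  exact (Ideal.ne_top_iff_one _).1 hm.ne_top (by simpa using sub_mem hrm hr)

end SmoothAlgebra

/-! ### Fields, points and tangent vectors on a product; the density argument. -/

section Product

variable {A B : Type*} [CommRing A] [Algebra ℂ A] [CommRing B] [Algebra ℂ B]

variable (B) in
/-- The extension of a field on the first factor to the product. -/
noncomputable def extendLeft (D : Derivation ℂ A A) : Derivation ℂ (A ⊗[ℂ] B) (A ⊗[ℂ] B) :=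
  Derivation.mk' ((D : A →ₗ[ℂ] A).rTensor B) fun F G => by
    induction F with
    | zero => simp
    | add F₁ F₂ h₁ h₂ => simp only [add_mul, map_add, h₁, h₂, smul_eq_mul, mul_add]; ring
    | tmul f₁ f₂ =>
      induction G with
      | zero => simp
      | add G₁ G₂ h₁ h₂ => simp only [add_mul, map_add, h₁, h₂, smul_eq_mul, mul_add]; ring
      | tmul g₁ g₂ => simp [TensorProduct.add_tmul, mul_comm f₂ g₂]

variable (A) in
/-- The extension of a field on the second factor to the product. -/
noncomputable def extendRight (D : Derivation ℂ B B) : Derivation ℂ (A ⊗[ℂ] B) (A ⊗[ℂ] B) :=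
  Derivation.mk' ((D : B →ₗ[ℂ] B).lTensor A) fun F G => by
    induction F with
    | zero => simp
    | add F₁ F₂ h₁ h₂ => simp only [add_mul, map_add, h₁, h₂, smul_eq_mul, mul_add]; ring
    | tmul f₁ f₂ =>
      induction G with
      | zero => simp
      | add G₁ G₂ h₁ h₂ => simp only [add_mul, map_add, h₁, h₂, smul_eq_mul, mul_add]; ring
      | tmul g₁ g₂ => simp [TensorProduct.tmul_add, mul_comm f₁ g₁]

@[simp] theorem extendLeft_tmul (D : Derivation ℂ A A) (f : A) (g : B) :
    extendLeft B D (f ⊗ₜ g) = D f ⊗ₜ g := rfl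

@[simp] theorem extendRight_tmul (D : Derivation ℂ B B) (f : A) (g : B) :
    extendRight A D (f ⊗ₜ g) = f ⊗ₜ D g := rfl

theorem lie_extend (D : Derivation ℂ A A) (E : Derivation ℂ B B) :
    ⁅extendLeft B D, extendRight A E⁆ = 0 := by
  ext F
  induction F with
  | zero => simp
  | add F G hF hG => rw [map_add, hF, hG, map_add]
  | tmul f g => simp [Derivation.commutator_apply]

/-- The point of the product with given components. -/
noncomputable abbrev pair (x : Point A) (y : Point B) : Point (A ⊗[ℂ] B) :=
  Algebra.TensorProduct.productMap x y

theorem exists_eq_pair (z : Point (A ⊗[ℂ] B)) : ∃ (x : Point A) (y : Point B), z = pair x y :=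
  ⟨z.comp Algebra.TensorProduct.includeLeft, z.comp Algebra.TensorProduct.includeRight, by
    ext f <;> simp [← Algebra.TensorProduct.one_def]⟩

theorem IsCompletelyIntegrable.extendLeft {D : Derivation ℂ A A} (hD : IsCompletelyIntegrable D) :
    IsCompletelyIntegrable (extendLeft B D) := by
  intro z
  obtain ⟨x, y, rfl⟩ := exists_eq_pair z
  obtain ⟨γ, h0, hγ⟩ := hD x
  refine ⟨fun t => pair (γ t) y, congrArg (pair · y) h0, fun F t => ?_⟩
  induction F with
  | zero => simpa using hasDerivAt_const t (0 : ℂ)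
  | add F G hF hG =>
    simp only [map_add]
    exact hF.add hG
  | tmul f g => simpa using (hγ f t).mul_const (y g)

theorem IsCompletelyIntegrable.extendRight {D : Derivation ℂ B B}
    (hD : IsCompletelyIntegrable D) : IsCompletelyIntegrable (extendRight A D) := by
  intro z
  obtain ⟨x, y, rfl⟩ := exists_eq_pair z
  obtain ⟨γ, h0, hγ⟩ := hD y
  refine ⟨fun t => pair x (γ t), congrArg (pair x) h0, fun F t => ?_⟩
  induction F with
  | zero => simpa using hasDerivAt_const t (0 : ℂ)
  | add F G hF hG =>
    simp only [map_add]
    exact hF.add hG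
  | tmul f g => simpa using (hγ g t).const_mul (x f)

theorem lie_smul_smul_field (D E : Derivation ℂ A A) (u v : A) :
    ⁅u • D, v • E⁆ = (u * D v) • E - (v * E u) • D + (u * v) • ⁅D, E⁆ := by
  ext g
  simp only [Derivation.commutator_apply, Derivation.smul_apply, Derivation.add_apply,
    Derivation.sub_apply, Derivation.leibniz, smul_eq_mul]
  ring

/-- The compatible pair argument: if `D (D a) = 0`, the multiples of `D a` times a field on the
second factor all lie in the Lie algebra generated by the integrable fields. -/
theorem smul_extendRight_mem_absorbedFields {D : Derivation ℂ A A} {E : Derivation ℂ B B}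
    (hD : IsCompletelyIntegrable D) (hE : IsCompletelyIntegrable E) {a : A} (ha : D (D a) = 0) :
    (D a ⊗ₜ[ℂ] (1 : B)) • extendRight A E ∈ absorbedFields (A ⊗[ℂ] B) := by
  intro F
  induction F with
  | zero => rw [zero_smul]; exact zero_mem _
  | add F G hF hG => rw [add_smul]; exact add_mem hF hG
  | tmul f g =>
    have hL := hD.extendLeft (B := B)
    have hR := hE.extendRight (A := A)
    have h1 : ((a ⊗ₜ[ℂ] g) • extendLeft B D) ∈ integrableLie (A ⊗[ℂ] B) :=
      (hL.smul (by simp [ha])).mem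
    have h2 : (((1 : A) ⊗ₜ[ℂ] g) • extendLeft B D) ∈ integrableLie (A ⊗[ℂ] B) :=
      (hL.smul_of_ker (by simp)).mem
    have h3 : ∀ f : A, ((f ⊗ₜ[ℂ] (1 : B)) • extendRight A E) ∈ integrableLie (A ⊗[ℂ] B) := fun f =>
      (hR.smul_of_ker (by simp)).mem
    -- The terms along `D` cancel in the difference of brackets, and `D (a f) - a D f = f D a`.
    convert sub_mem ((integrableLie (A ⊗[ℂ] B)).lie_mem h2 (h3 (a * f)))
      ((integrableLie (A ⊗[ℂ] B)).lie_mem h1 (h3 f)) using 1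
    rw [lie_smul_smul_field, lie_smul_smul_field, lie_extend]
    simp only [smul_zero, add_zero, extendLeft_tmul, extendRight_tmul,
      Algebra.TensorProduct.tmul_mul_tmul, Derivation.leibniz, smul_eq_mul, one_mul, mul_one,
      TensorProduct.add_tmul, mul_add, add_smul, smul_smul, mul_comm f]
    abel

/-- Brackets with fields of the first factor produce multiples of those fields. -/
theorem smul_extendLeft_mem_absorbedFields {D : Derivation ℂ A A} {E : Derivation ℂ B B}
    (hD : IsCompletelyIntegrable D) {b : A}
    (hb : (b ⊗ₜ[ℂ] (1 : B)) • extendRight A E ∈ absorbedFields (A ⊗[ℂ] B)) (g : B) :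
    (b ⊗ₜ[ℂ] E g) • extendLeft B D ∈ absorbedFields (A ⊗[ℂ] B) := by
  have hL := hD.extendLeft (B := B)
  have h1 := (absorbedFields (A ⊗[ℂ] B)).smul_mem ((1 : A) ⊗ₜ[ℂ] g) (lie_mem_absorbedFields hL.mem hb)
  have h2 := lie_mem_absorbedFields (hL.smul_of_ker (h := (1 : A) ⊗ₜ[ℂ] g) (by simp)).mem hb
  convert sub_mem h1 h2 using 1
  rw [lie_smul_smul_field, lie_smul_field, lie_extend]
  simp [smul_smul]

/-- The inclusion of functionals on the first factor determined by a point of the second. -/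
noncomputable def inclLeft (y : Point B) : (A →ₗ[ℂ] ℂ) →ₗ[ℂ] (A ⊗[ℂ] B →ₗ[ℂ] ℂ) where
  toFun v := LinearMap.mul' ℂ ℂ ∘ₗ TensorProduct.map v y.toLinearMap
  map_add' v w := by ext; simp [add_mul]
  map_smul' c v := by ext; simp [mul_assoc]

/-- The inclusion of functionals on the second factor determined by a point of the first. -/
noncomputable def inclRight (x : Point A) : (B →ₗ[ℂ] ℂ) →ₗ[ℂ] (A ⊗[ℂ] B →ₗ[ℂ] ℂ) where
  toFun v := LinearMap.mul' ℂ ℂ ∘ₗ TensorProduct.map x.toLinearMap v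
  map_add' v w := by ext; simp [mul_add]
  map_smul' c v := by ext; simp [mul_left_comm]

@[simp] theorem inclLeft_tmul (y : Point B) (v : A →ₗ[ℂ] ℂ) (f : A) (g : B) :
    inclLeft y v (f ⊗ₜ g) = v f * y g := rfl

@[simp] theorem inclRight_tmul (x : Point A) (v : B →ₗ[ℂ] ℂ) (f : A) (g : B) :
    inclRight x v (f ⊗ₜ g) = x f * v g := rfl

theorem tangentSpace_pair {x : Point A} {y : Point B} {v : A ⊗[ℂ] B →ₗ[ℂ] ℂ}
    (hv : v ∈ tangentSpace (pair x y)) :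
    ∃ u ∈ tangentSpace x, ∃ w ∈ tangentSpace y, v = inclLeft y u + inclRight x w := by
  refine ⟨v ∘ₗ (Algebra.TensorProduct.includeLeft : A →ₐ[ℂ] A ⊗[ℂ] B).toLinearMap, fun f g => ?_,
    v ∘ₗ (Algebra.TensorProduct.includeRight : B →ₐ[ℂ] A ⊗[ℂ] B).toLinearMap, fun f g => ?_, ?_⟩
  · simpa using hv (f ⊗ₜ 1) (g ⊗ₜ 1)
  · simpa using hv (1 ⊗ₜ f) (1 ⊗ₜ g)
  · ext f g
    have := hv (f ⊗ₜ 1) (1 ⊗ₜ g)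
    simp only [Algebra.TensorProduct.tmul_mul_tmul, one_mul, mul_one,
      Algebra.TensorProduct.productMap_apply_tmul, map_one] at this
    simp [this]
    ring

/-- A subspace of functionals that is stable under the isotropy group and contains a generating
set contains the tangent space. -/
theorem mem_of_isGeneratingSet {x : Point A} {ι : Type*} {δ : ι → Derivation ℂ A A}
    (hx : IsGeneratingSet x (Set.range fun k => valueAt (δ k) x)) (W : Submodule ℂ (A →ₗ[ℂ] ℂ))
    (hW : ∀ φ : A ≃ₐ[ℂ] A, movePoint φ x = x → ∀ v ∈ W, v ∘ₗ φ.toLinearMap ∈ W)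
    (hδ : ∀ k, x.toLinearMap ∘ₗ (δ k : A →ₗ[ℂ] A) ∈ W) {v : A →ₗ[ℂ] ℂ} (hv : v ∈ tangentSpace x) :
    v ∈ W := by
  suffices h : (⊤ : Submodule ℂ (tangentSpace x)) ≤ W.comap (tangentSpace x).subtype from
    h (show (⟨v, hv⟩ : tangentSpace x) ∈ ⊤ from trivial)
  rw [← hx.2, Submodule.span_le]
  rintro w ⟨φ, hφ, -, ⟨k, rfl⟩, h⟩
  have : (w : A →ₗ[ℂ] ℂ) = (x.toLinearMap ∘ₗ (δ k : A →ₗ[ℂ] A)) ∘ₗ φ.toLinearMap :=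
    LinearMap.ext h
  simpa [this] using hW φ hφ _ (hδ k)

/-- Take the next-to-last nonzero iterate on a function that `D` does not kill. -/
theorem IsLocallyNilpotent.exists_apply_apply_eq_zero {D : Derivation ℂ A A}
    (hD : IsLocallyNilpotent D) (h : D ≠ 0) : ∃ a, D a ≠ 0 ∧ D (D a) = 0 := by
  obtain ⟨f, hf⟩ : ∃ f, D f ≠ 0 := by
    by_contra! h'
    exact h (Derivation.ext h')
  classical
  have hn := Nat.find_spec (hD (D f))
  obtain ⟨n, hn'⟩ : ∃ n, Nat.find (hD (D f)) = n + 1 :=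
    Nat.exists_eq_succ_of_ne_zero fun h0 => hf (by simpa [h0] using hn)
  refine ⟨(⇑D)^[n] f, ?_, ?_⟩
  · rw [← Function.iterate_succ_apply' (⇑D), Function.iterate_succ_apply]
    exact Nat.find_min (hD (D f)) (by omega)
  · rw [← Function.iterate_succ_apply' (⇑D), ← Function.iterate_succ_apply' (⇑D), Function.iterate_succ_apply,
      ← hn']
    exact hn

theorem movePoint_refl (x : Point A) : movePoint AlgEquiv.refl x = x := by
  ext; simp [movePoint]

theorem movePoint_congr_pair (φ : A ≃ₐ[ℂ] A) (ψ : B ≃ₐ[ℂ] B) (x : Point A) (y : Point B) :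
    movePoint (Algebra.TensorProduct.congr φ ψ) (pair x y) =
      pair (movePoint φ x) (movePoint ψ y) := by
  ext f <;> simp [movePoint]

theorem hasAlgebraicDensityProperty_tensorProduct [Algebra.Smooth ℂ A] [Algebra.Smooth ℂ B]
    (hA : IsHomogeneous A) (hB : IsHomogeneous B) {ι κ : Type*}
    {δ : ι → Derivation ℂ A A} {ε : κ → Derivation ℂ B B}
    (hδ : ∀ i, IsLocallyNilpotent (δ i)) (hε : ∀ k, IsCompletelyIntegrable (ε k))
    {x : Point A} {y : Point B}
    (hx : IsGeneratingSet x (Set.range fun i => valueAt (δ i) x))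
    (hy : IsGeneratingSet y (Set.range fun k => valueAt (ε k) y))
    (hδ0 : ∃ i, δ i ≠ 0) (hε0 : ∃ k g, y (ε k g) ≠ 0) :
    HasAlgebraicDensityProperty (A ⊗[ℂ] B) := by
  have : Algebra.Smooth ℂ (A ⊗[ℂ] B) := Algebra.Smooth.comp ℂ A _
  -- By reducedness the derivative is nonzero at some point `z`; an automorphism moves `z` to `x`,
  -- and conjugation keeps local nilpotency.
  obtain ⟨D, hD, a, ha, hxa⟩ : ∃ D : Derivation ℂ A A, IsLocallyNilpotent D ∧
      ∃ a, D (D a) = 0 ∧ x (D a) ≠ 0 := by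
    obtain ⟨i, hi⟩ := hδ0
    obtain ⟨a, h1, h2⟩ := (hδ i).exists_apply_apply_eq_zero hi
    obtain ⟨z, hz⟩ : ∃ z : Point A, z (δ i a) ≠ 0 := by
      by_contra! h
      exact h1 (eq_zero_of_forall_point h)
    obtain ⟨φ, rfl⟩ := hA x z
    exact ⟨conj φ (δ i), (hδ i).conj φ, φ a, by simp [h2], by simpa [movePoint] using hz⟩
  have hR := fun k => smul_extendRight_mem_absorbedFields hD.isCompletelyIntegrable (hε k) ha
  have hL := fun i k g =>
    smul_extendLeft_mem_absorbedFields (hδ i).isCompletelyIntegrable (hR k) g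
  let W := absorbedFiber (pair x y)
  have hWR : ∀ k, inclRight x (y.toLinearMap ∘ₗ (ε k : B →ₗ[ℂ] B)) ∈ W := by
    intro k
    have : (x (D a)) • inclRight x (y.toLinearMap ∘ₗ (ε k : B →ₗ[ℂ] B)) ∈ W := by
      refine ⟨_, hR k, fun F => ?_⟩
      induction F with
      | zero => simp
      | add F G hF hG => rw [map_add, hF, hG, map_add, map_add]
      | tmul f g => simp [mul_assoc]
    exact (W.smul_mem_iff hxa).1 this
  have hWL : ∀ i, inclLeft y (x.toLinearMap ∘ₗ (δ i : A →ₗ[ℂ] A)) ∈ W := by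
    intro i
    obtain ⟨k, g, hg⟩ := hε0
    have : (x (D a) * y (ε k g)) • inclLeft y (x.toLinearMap ∘ₗ (δ i : A →ₗ[ℂ] A)) ∈ W := by
      refine ⟨_, hL i k g, fun F => ?_⟩
      induction F with
      | zero => simp
      | add F G hF hG => rw [map_add, hF, hG, map_add, map_add]
      | tmul f g => simp; ring
    exact (W.smul_mem_iff (mul_ne_zero hxa hg)).1 this
  have hWA : ∀ v ∈ tangentSpace x, inclLeft y v ∈ W := fun v hv => by
    refine mem_of_isGeneratingSet hx (W.comap (inclLeft y)) (fun φ hφ v hv => ?_) hWL hv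
    -- An isotropy automorphism of one factor, extended by the identity, fixes the pair and
    -- preserves the fibre.
    have := comp_mem_absorbedFiber hv (Algebra.TensorProduct.congr φ AlgEquiv.refl)
    rw [movePoint_congr_pair, hφ, movePoint_refl] at this
    rw [Submodule.mem_comap]
    convert this using 1
    ext f g
    simp
  have hWB : ∀ v ∈ tangentSpace y, inclRight x v ∈ W := fun v hv => by
    refine mem_of_isGeneratingSet hy (W.comap (inclRight x)) (fun φ hφ v hv => ?_) hWR hv
    have := comp_mem_absorbedFiber hv (Algebra.TensorProduct.congr AlgEquiv.refl φ)
    rw [movePoint_congr_pair, hφ, movePoint_refl] at this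
    rw [Submodule.mem_comap]
    convert this using 1
    ext f g
    simp
  have hW : ∀ v ∈ tangentSpace (pair x y), v ∈ W := by
    intro v hv
    obtain ⟨u, hu, w, hw, rfl⟩ := tangentSpace_pair hv
    exact add_mem (hWA u hu) (hWB w hw)
  refine hasAlgebraicDensityProperty_of_fiber fun z v hv => ?_
  obtain ⟨x', y', rfl⟩ := exists_eq_pair z
  obtain ⟨φ, rfl⟩ := hA x x'
  obtain ⟨ψ, rfl⟩ := hB y y'
  have hm := movePoint_congr_pair φ ψ x y
  rw [← hm] at hv ⊢
  set Φ := Algebra.TensorProduct.congr φ ψ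
  have h1 := comp_mem_absorbedFiber (hW (v ∘ₗ Φ.symm.toLinearMap) fun f g => by
    simpa [movePoint] using hv (Φ.symm f) (Φ.symm g)) Φ
  convert h1 using 1
  ext; simp

/-- On a homogeneous smooth variety of positive dimension, a generating set at a point contains
a non-zero vector. -/
theorem IsGeneratingSet.exists_apply_ne_zero [Algebra.Smooth ℂ A]
    (hdim : 0 < ringKrullDim A) (hA : IsHomogeneous A) {ι : Type*} {δ : ι → Derivation ℂ A A}
    {x : Point A} (hx : IsGeneratingSet x (Set.range fun i => valueAt (δ i) x)) :
    ∃ i f, x (δ i f) ≠ 0 := by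
  by_contra! h
  obtain ⟨z, D, f, hz⟩ := exists_apply_ne_zero_of_ringKrullDim_pos hdim
  obtain ⟨φ, rfl⟩ := hA x z
  have := mem_of_isGeneratingSet hx ⊥ (fun φ _ v hv => by simp_all)
    (fun i => by rw [Submodule.mem_bot]; ext f; exact h i f) (valueAt (conj φ D) x).2
  rw [Submodule.mem_bot] at this
  refine hz ?_
  simpa [valueAt, movePoint] using LinearMap.congr_fun this (φ f)

end Product

/-! ### Affine spaces and tori. -/

section Examples

theorem isGeneratingSet_range {A : Type*} [CommRing A] [Algebra ℂ A] {x : Point A} {ι : Type*}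
    [Finite ι] {δ : ι → Derivation ℂ A A}
    (h : ∀ v ∈ tangentSpace x, v ∈ Submodule.span ℂ
      (Set.range fun i => x.toLinearMap ∘ₗ (δ i : A →ₗ[ℂ] A))) :
    IsGeneratingSet x (Set.range fun i => valueAt (δ i) x) := by
  refine ⟨Set.finite_range _, eq_top_iff.2 fun v _ => ?_⟩
  have hv := h v v.2
  have hr : (Set.range fun i => x.toLinearMap ∘ₗ (δ i : A →ₗ[ℂ] A)) =
      (tangentSpace x).subtype '' Set.range fun i => valueAt (δ i) x := by
    rw [← Set.range_comp]; rfl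
  rw [hr, ← Submodule.map_span, Submodule.mem_map] at hv
  obtain ⟨w, hw, hwv⟩ := hv
  obtain rfl : w = v := Subtype.ext hwv
  refine Submodule.span_mono ?_ hw
  intro u hu
  exact ⟨AlgEquiv.refl, movePoint_refl x, u, hu, fun f => rfl⟩

theorem tangentSpace_apply_algebraMap {A : Type*} [CommRing A] [Algebra ℂ A] {x : Point A}
    {v : A →ₗ[ℂ] ℂ} (hv : v ∈ tangentSpace x) (c : ℂ) : v (algebraMap ℂ A c) = 0 := by
  have h1 : v 1 = 0 := by simpa using hv 1 1
  rw [Algebra.algebraMap_eq_smul_one, map_smul, h1, smul_zero]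

section AffineSpace

variable {σ : Type*}

instance smooth_mvPolynomial [Finite σ] : Algebra.Smooth ℂ (MvPolynomial σ ℂ) where

theorem isHomogeneous_mvPolynomial : IsHomogeneous (MvPolynomial σ ℂ) := by
  intro x y
  refine ⟨AlgEquiv.ofAlgHom
    (MvPolynomial.aeval fun i => MvPolynomial.X i + MvPolynomial.C (y (.X i) - x (.X i)))
    (MvPolynomial.aeval fun i => MvPolynomial.X i - MvPolynomial.C (y (.X i) - x (.X i)))
    ?_ ?_, ?_⟩
  · ext i; simp [MvPolynomial.algHom_C]
  · ext i; simp [MvPolynomial.algHom_C]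
  · ext i; simp [movePoint, MvPolynomial.algHom_C]

theorem isLocallyNilpotent_pderiv (i : σ) :
    IsLocallyNilpotent (MvPolynomial.pderiv i : Derivation ℂ (MvPolynomial σ ℂ) _) := by
  classical
  intro f
  induction f using MvPolynomial.induction_on with
  | C a => exact ⟨1, by simp⟩
  | add f g hf hg =>
    obtain ⟨n, hn⟩ := hf
    obtain ⟨m, hm⟩ := hg
    refine ⟨max n m, ?_⟩
    rw [iterate_map_add, iterate_eq_zero_of_le (le_max_left n m) hn,
      iterate_eq_zero_of_le (le_max_right n m) hm, add_zero]
  | mul_X f j hf =>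
    obtain ⟨n, hn⟩ := hf
    -- Only the nilpotency half is used, so the base point is arbitrary; two derivatives kill a
    -- variable.
    refine ⟨n + 2, (taylor_mul_aux _ (MvPolynomial.aeval 0) (n + 2) n 2 f (.X j) le_rfl hn ?_).1⟩
    by_cases h : i = j
    · subst h; simp
    · simp [MvPolynomial.pderiv_X_of_ne (Ne.symm h)]

theorem isGeneratingSet_pderiv [Finite σ] (x : Point (MvPolynomial σ ℂ)) :
    IsGeneratingSet x (Set.range fun i : σ => valueAt (MvPolynomial.pderiv i) x) := by
  classical
  have := Fintype.ofFinite σ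
  refine isGeneratingSet_range fun v hv => ?_
  have : v = ∑ i, v (.X i) • (x.toLinearMap ∘ₗ
      ((MvPolynomial.pderiv i : Derivation ℂ (MvPolynomial σ ℂ) _) :
        MvPolynomial σ ℂ →ₗ[ℂ] MvPolynomial σ ℂ)) := by
    refine LinearMap.ext fun f => ?_
    induction f using MvPolynomial.induction_on with
    | C a => simpa [LinearMap.sum_apply] using tangentSpace_apply_algebraMap hv a
    | add f g hf hg => rw [map_add, map_add, hf, hg]
    | mul_X f j hf =>
      rw [hv, hf]
      simp [LinearMap.sum_apply, MvPolynomial.pderiv_X, Pi.single_apply, Finset.sum_add_distrib,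
        apply_ite, mul_add, Finset.mul_sum, mul_left_comm, mul_comm]
  rw [this]
  exact Submodule.sum_mem _ fun i _ => Submodule.smul_mem _ _ (Submodule.subset_span ⟨i, rfl⟩)

end AffineSpace

section Torus

/-- The algebra of Laurent polynomials, the regular functions on a torus. -/
abbrev Torus (l : ℕ) : Type := AddMonoidAlgebra ℂ (Fin l → ℤ)

variable {l : ℕ}

/-- The Laurent monomial with a given exponent. -/
noncomputable abbrev character (g : Fin l → ℤ) : Torus l := AddMonoidAlgebra.single g 1

theorem eq_sum_smul_single (g : Fin l → ℤ) : g = ∑ i, g i • (Pi.single i 1 : Fin l → ℤ) := by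
  ext j
  simp [Finset.sum_apply, Pi.single_apply]

theorem character_add (g h : Fin l → ℤ) : character (g + h) = character g * character h := by
  simp [AddMonoidAlgebra.single_mul_single]

theorem character_zero : character (0 : Fin l → ℤ) = 1 := rfl

theorem single_eq_smul_character (g : Fin l → ℤ) (c : ℂ) :
    (AddMonoidAlgebra.single g c : Torus l) = c • character g := by simp

theorem torus_induction {p : Torus l → Prop} (f : Torus l) (zero : p 0)
    (add : ∀ f g, p f → p g → p (f + g)) (smul : ∀ (c : ℂ) f, p f → p (c • f))
    (char : ∀ g, p (character g)) : p f := by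
  induction f using AddMonoidAlgebra.induction_linear with
  | zero => exact zero
  | add f g hf hg => exact add f g hf hg
  | single g c => rw [single_eq_smul_character]; exact smul _ _ (char g)

theorem point_character_ne_zero (x : Point (Torus l)) (g : Fin l → ℤ) : x (character g) ≠ 0 := by
  intro h
  have := congrArg x (character_add g (-g))
  rw [map_mul, h, zero_mul, add_neg_cancel, character_zero, map_one] at this
  exact one_ne_zero this

/-- The homomorphism determined by a character of the lattice. -/
noncomputable def torusLift {R : Type*} [CommRing R] [Algebra ℂ R] (F : (Fin l → ℤ) → R)
    (h0 : F 0 = 1) (hadd : ∀ g h, F (g + h) = F g * F h) : Torus l →ₐ[ℂ] R :=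
  AddMonoidAlgebra.lift ℂ R (Fin l → ℤ)
    { toFun := fun g => F g.toAdd, map_one' := h0, map_mul' := fun g h => hadd g.toAdd h.toAdd }

@[simp] theorem torusLift_character {R : Type*} [CommRing R] [Algebra ℂ R] (F : (Fin l → ℤ) → R)
    (h0 : F 0 = 1) (hadd : ∀ g h, F (g + h) = F g * F h) (g : Fin l → ℤ) :
    torusLift F h0 hadd (character g) = F g := by
  simp [torusLift]

theorem torus_algHom_ext {R : Type*} [CommRing R] [Algebra ℂ R] {φ ψ : Torus l →ₐ[ℂ] R}
    (h : ∀ g, φ (character g) = ψ (character g)) : φ = ψ := by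
  refine AlgHom.ext fun f => ?_
  induction f using torus_induction with
  | zero => simp
  | add f g hf hg => rw [map_add, hf, hg, map_add]
  | smul c f hf => rw [map_smul, hf, map_smul]
  | char g => exact h g

/-- The torus acts on itself: scaling each character by the ratio of its values at `y` and `x` moves
`x` to `y`. -/
theorem isHomogeneous_torus : IsHomogeneous (Torus l) := by
  intro x y
  let F (x y : Point (Torus l)) (g : Fin l → ℤ) : Torus l :=
    (y (character g) * x (character (-g))) • character g
  have h0 : ∀ x y, F x y 0 = 1 := by
    intro x y
    simp only [F, neg_zero, character_zero, map_one, mul_one, one_smul]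
  have hadd : ∀ x y g h, F x y (g + h) = F x y g * F x y h := by
    intro x y g h
    simp only [F, neg_add, character_add, map_mul, smul_mul_smul_comm]
    congr 1
    ring
  have hinv : ∀ (x : Point (Torus l)) g, x (character g) * x (character (-g)) = 1 := by
    intro x g
    rw [← map_mul, ← character_add, add_neg_cancel, character_zero, map_one]
  have hcomp : ∀ x y, (torusLift (F x y) (h0 x y) (hadd x y)).comp
      (torusLift (F y x) (h0 y x) (hadd y x)) = AlgHom.id ℂ _ := by
    intro x y
    refine torus_algHom_ext fun g => ?_
    rw [AlgHom.comp_apply, torusLift_character, map_smul, torusLift_character, smul_smul,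
      show x (character g) * y (character (-g)) * (y (character g) * x (character (-g))) = 1 by
        linear_combination (y (character g) * y (character (-g))) * hinv x g + hinv y g, one_smul]
    rfl
  refine ⟨AlgEquiv.ofAlgHom _ _ (hcomp x y) (hcomp y x), torus_algHom_ext fun g => ?_⟩
  change x (torusLift (F x y) (h0 x y) (hadd x y) (character g)) = _
  rw [torusLift_character, map_smul, smul_eq_mul, mul_assoc, mul_comm (x _), hinv, mul_one]

/-- Maps out of the Laurent algebra are choices of `l` units, and units lift along square-zero
ideals. -/
instance smooth_torus : Algebra.Smooth ℂ (Torus l) where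
  finitePresentation := (Algebra.FinitePresentation.of_finiteType).1 inferInstance
  formallySmooth := by
    refine Algebra.FormallySmooth.of_comp_surjective fun B _ _ I hI ψ => ?_
    let e : Fin l → Fin l → ℤ := fun i => Pi.single i 1
    have hu : ∀ i, ∃ u : Bˣ, Ideal.Quotient.mk I u = ψ (character (e i)) := by
      intro i
      obtain ⟨b, hb⟩ := Ideal.Quotient.mk_surjective (ψ (character (e i)))
      have h1 : IsUnit (Ideal.Quotient.mk I b) := by
        rw [hb]
        refine IsUnit.of_mul_eq_one (ψ (character (-e i))) ?_
        rw [← map_mul, ← character_add, add_neg_cancel, character_zero, map_one]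
      have h2 := (IsNilpotent.isUnit_quotient_mk_iff ⟨2, hI⟩).1 h1
      exact ⟨h2.unit, hb⟩
    choose u hu using hu
    let F : Torus l →ₐ[ℂ] B := torusLift (fun g => ((∏ i, u i ^ g i : Bˣ) : B)) (by simp)
      fun g h => by simp [zpow_add, Finset.prod_mul_distrib]
    refine ⟨F, torus_algHom_ext fun g => ?_⟩
    -- In the group of units negative powers make sense, so it suffices to compare on the basis of
    -- the lattice.
    let χ (θ : Torus l →ₐ[ℂ] B ⧸ I) : Multiplicative (Fin l → ℤ) →* B ⧸ I :=
      (θ : Torus l →* B ⧸ I).comp (AddMonoidAlgebra.of ℂ (Fin l → ℤ))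
    suffices h : (χ ((Ideal.Quotient.mkₐ ℂ I).comp F)).toHomUnits = (χ ψ).toHomUnits from
      congrArg Units.val (DFunLike.congr_fun h (Multiplicative.ofAdd g))
    refine MonoidHom.ext fun g => ?_
    rw [← ofAdd_toAdd g, eq_sum_smul_single g.toAdd, ofAdd_sum, map_prod, map_prod]
    simp only [ofAdd_zsmul, map_zpow]
    congr 2
    ext1 i
    congr 1
    ext
    change Ideal.Quotient.mk I (F (character (e i))) = ψ (character (e i))
    rw [← hu, torusLift_character, Finset.prod_eq_single i]
    · simp [e]
    · intro j _ hj
      simp [e, hj]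
    · simp

/-- The invariant field `zᵢ ∂/∂zᵢ` on the torus. -/
noncomputable def torusField (i : Fin l) : Derivation ℂ (Torus l) (Torus l) :=
  Derivation.mk' (Finsupp.lsum ℂ (fun g : Fin l → ℤ =>
    (g i : ℂ) • (LinearMap.toSpanSingleton ℂ (Torus l) (character g))) ∘ₗ
      (AddMonoidAlgebra.coeffLinearEquiv ℂ).toLinearMap) fun f g => by
    induction f using torus_induction with
    | zero => simp
    | add f₁ f₂ h₁ h₂ => simp only [add_mul, map_add, h₁, h₂, smul_eq_mul, mul_add]; ring
    | smul c f hf =>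
      rw [smul_mul_assoc, map_smul, map_smul, hf, smul_add, smul_assoc, smul_comm g c]
    | char p =>
      induction g using torus_induction with
      | zero => simp
      | add f₁ f₂ h₁ h₂ => simp only [add_mul, map_add, h₁, h₂, smul_eq_mul, mul_add]; ring
      | smul c f hf =>
        rw [mul_smul_comm, map_smul, map_smul, hf, smul_add, smul_assoc, smul_comm (character p) c]
      | char q =>
        rw [← character_add]
        simp [AddMonoidAlgebra.single_mul_single, add_comm q p, ← AddMonoidAlgebra.single_add,
          add_comm]

@[simp] theorem torusField_character (i : Fin l) (g : Fin l → ℤ) :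
    torusField i (character g) = (g i : ℂ) • character g := by
  simp [torusField]

theorem isCompletelyIntegrable_torusField (i : Fin l) :
    IsCompletelyIntegrable (torusField i) := by
  intro x
  refine ⟨fun t => torusLift (fun g => x (character g) * Complex.exp (g i * t))
    (by simp [character_zero]) fun g h => ?_, torus_algHom_ext fun g => by simp, fun f t => ?_⟩
  · rw [character_add, map_mul, Pi.add_apply, Int.cast_add, add_mul, Complex.exp_add]
    ring
  · induction f using torus_induction with
    | zero => simpa using hasDerivAt_const t (0 : ℂ)
    | add f g hf hg => simp only [map_add]; exact hf.add hg
    | smul c f hf => simp only [map_smul, Derivation.map_smul]; exact hf.const_mul c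
    | char g =>
      simp only [torusField_character, map_smul, torusLift_character]
      refine HasDerivAt.congr_deriv
        ((((hasDerivAt_id t).const_mul (g i : ℂ)).cexp).const_mul (x (character g))) ?_
      simp only [id, mul_one, smul_eq_mul]
      ring

theorem isGeneratingSet_torusField (x : Point (Torus l)) :
    IsGeneratingSet x (Set.range fun i : Fin l => valueAt (torusField i) x) := by
  refine isGeneratingSet_range fun v hv => ?_
  let e : Fin l → Fin l → ℤ := fun i => Pi.single i 1
  -- The logarithmic derivative along `v` is additive in the character, hence fixed by its values on
  -- the basis.
  let L : (Fin l → ℤ) →+ ℂ :=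
    { toFun := fun g => v (character g) / x (character g)
      map_zero' := by
        have := tangentSpace_apply_algebraMap hv 1
        rw [map_one] at this
        simp [character_zero, this]
      map_add' := fun g h => by
        have h1 := point_character_ne_zero x g
        have h2 := point_character_ne_zero x h
        rw [character_add, hv, map_mul]
        field_simp
        ring }
  have : v = ∑ i, L (e i) • (x.toLinearMap ∘ₗ (torusField i : Torus l →ₗ[ℂ] Torus l)) := by
    refine LinearMap.ext fun f => ?_
    induction f using torus_induction with
    | zero => simp
    | add f g hf hg => rw [map_add, map_add, hf, hg]
    | smul c f hf => rw [map_smul, map_smul, hf]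
    | char g =>
      have h1 : v (character g) = L g * x (character g) :=
        (div_mul_cancel₀ _ (point_character_ne_zero x g)).symm
      have h2 : L g = ∑ i, (g i : ℂ) * L (e i) := by
        conv_lhs => rw [eq_sum_smul_single g]
        rw [map_sum]
        exact Finset.sum_congr rfl fun i _ => by rw [map_zsmul, zsmul_eq_mul]
      rw [h1, h2]
      simp only [LinearMap.sum_apply, LinearMap.smul_apply,
        LinearMap.comp_apply, Derivation.coeFn_coe, torusField_character, map_smul,
        AlgHom.toLinearMap_apply, smul_eq_mul, Finset.sum_mul]
      exact Finset.sum_congr rfl fun i _ => by ring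
  rw [this]
  exact Submodule.sum_mem _ fun i _ => Submodule.smul_mem _ _ (Submodule.subset_span ⟨i, rfl⟩)

end Torus

theorem hasAlgebraicDensityProperty_affineTorusProduct {k l : ℕ} (hk : 1 ≤ k) (hkl : 2 ≤ k + l) :
    HasAlgebraicDensityProperty (AffineTorusProduct k l) := by
  have hpd : ∀ n, 1 ≤ n → ∃ i : Fin n,
      (MvPolynomial.pderiv i : Derivation ℂ (MvPolynomial (Fin n) ℂ) _) ≠ 0 := by
    intro n hn
    refine ⟨⟨0, hn⟩, fun h => ?_⟩
    have := DFunLike.congr_fun h (MvPolynomial.X ⟨0, hn⟩)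
    simp at this
  rcases Nat.eq_zero_or_pos l with rfl | hl
  -- With no torus factor, the second factor would be a point; instead split off one line from the
  -- affine space.
  · obtain ⟨n, rfl⟩ : ∃ n, k = n + 1 := ⟨k - 1, by omega⟩
    have h := hasAlgebraicDensityProperty_tensorProduct
      (isHomogeneous_mvPolynomial (σ := Fin n)) (isHomogeneous_mvPolynomial (σ := Fin 1))
      isLocallyNilpotent_pderiv (fun i => (isLocallyNilpotent_pderiv i).isCompletelyIntegrable)
      (isGeneratingSet_pderiv (MvPolynomial.aeval 0)) (isGeneratingSet_pderiv (MvPolynomial.aeval 0))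
      (hpd n (by omega)) ⟨0, MvPolynomial.X 0, by simp⟩
    refine h.of_algEquiv ?_
    let e₁ := ((MvPolynomial.algebraTensorAlgEquiv (σ := Fin 1) ℂ
      (MvPolynomial (Fin n) ℂ)).restrictScalars ℂ)
    let e₂ := (MvPolynomial.sumAlgEquiv ℂ (Fin 1) (Fin n)).symm
    let e₃ := MvPolynomial.renameEquiv ℂ ((Equiv.sumComm (Fin 1) (Fin n)).trans finSumFinEquiv)
    let e₄ := (Algebra.TensorProduct.rid ℂ ℂ (MvPolynomial (Fin (n + 1)) ℂ)).symm
    let e₅ := Algebra.TensorProduct.congr (AlgEquiv.refl : MvPolynomial (Fin (n + 1)) ℂ ≃ₐ[ℂ] _)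
      (AddMonoidAlgebra.uniqueAlgEquiv (A := ℂ) ℂ (Fin 0 → ℤ)).symm
    exact (((e₁.trans e₂).trans e₃).trans e₄).trans e₅
  · let x : Point (Torus l) := torusLift (fun _ => 1) rfl fun _ _ => (one_mul 1).symm
    exact hasAlgebraicDensityProperty_tensorProduct isHomogeneous_mvPolynomial isHomogeneous_torus
      isLocallyNilpotent_pderiv isCompletelyIntegrable_torusField
      (isGeneratingSet_pderiv (MvPolynomial.aeval 0)) (isGeneratingSet_torusField x)
      (hpd k hk) ⟨⟨0, hl⟩, character (Pi.single ⟨0, hl⟩ 1), by simp [x]⟩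

end Examples
end AffineManifold

theorem corollary2p10 :
    (∀ (A₁ : Type*) [CommRing A₁] [Algebra ℂ A₁] [Algebra.Smooth ℂ A₁]
      (A₂ : Type*) [CommRing A₂] [Algebra ℂ A₂] [Algebra.Smooth ℂ A₂]
      (_hdim₁ : 0 < ringKrullDim A₁) (_hdim₂ : 0 < ringKrullDim A₂)
      (_hhom₁ : AffineManifold.IsHomogeneous A₁) (_hhom₂ : AffineManifold.IsHomogeneous A₂)
      (m₁ m₂ : ℕ) (δ₁ : Fin m₁ → Derivation ℂ A₁ A₁) (δ₂ : Fin m₂ → Derivation ℂ A₂ A₂)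
      (_hδ₁ : ∀ k, AffineManifold.IsLocallyNilpotent (δ₁ k))
      (_hδ₂ : ∀ k, AffineManifold.IsCompletelyIntegrable (δ₂ k))
      (x₁ : AffineManifold.Point A₁) (x₂ : AffineManifold.Point A₂)
      (_hx₁ : AffineManifold.IsGeneratingSet x₁
        (Set.range fun k => AffineManifold.valueAt (δ₁ k) x₁))
      (_hx₂ : AffineManifold.IsGeneratingSet x₂
        (Set.range fun k => AffineManifold.valueAt (δ₂ k) x₂)),
      AffineManifold.HasAlgebraicDensityProperty (A₁ ⊗[ℂ] A₂)) ∧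
    (∀ k l : ℕ, 1 ≤ k → 2 ≤ k + l →
      AffineManifold.HasAlgebraicDensityProperty (AffineManifold.AffineTorusProduct k l)) := by
  refine ⟨?_, fun k l hk hkl =>
    AffineManifold.hasAlgebraicDensityProperty_affineTorusProduct hk hkl⟩
  intro A₁ _ _ _ A₂ _ _ _ hdim₁ hdim₂ hhom₁ hhom₂ m₁ m₂ δ₁ δ₂ hδ₁ hδ₂ x₁ x₂ hx₁ hx₂
  refine AffineManifold.hasAlgebraicDensityProperty_tensorProduct hhom₁ hhom₂ hδ₁ hδ₂ hx₁ hx₂ ?_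
    (hx₂.exists_apply_ne_zero hdim₂ hhom₂)
  obtain ⟨i, f, hf⟩ := hx₁.exists_apply_ne_zero hdim₁ hhom₁
  exact ⟨i, fun h => hf (by rw [h, Derivation.zero_apply, map_zero])⟩
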